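/- Let $d,s\ge 1$ be integers and let $\Lambda=s\mathbb{Z}^d\subset\mathbb{R}^d$. A polyhedron in $\mathbb{R}^d$ is an intersection of finitely many closed halfspaces, and a polytope is a bounded polyhedron. A polyhedron $P$ is integral if $P=\operatorname{conv}(P\cap\mathbb{Z}^d)$, and $\Lambda$-free if $\operatorname{int}(P)\cap\Lambda=\emptyset$. Let $\mathcal{P}^d_{\mathrm{ifm}}(s)$ be the class of those $\Lambda$-free integral polyhedra in $\mathbb{R}^d$ (bounded or not) that are not properly contained in another $\Lambda$-free integral polyhedron. Call a real number $\lambda>0$ admissible for $(d,s)$ if, for every $d$-dimensional integral simplex $S\subset\mathbb{R}^d$ with precisely one interior point $p$ in $s\mathbb{Z}^d$, all barycentric coordinates of $p$ with respect to $S$ are at least $\lambda$. Then: 1. There is a constant $N(d,s)>0$, depending only on $d$ and $s$, such that every polytope $P\in\mathcal{P}^d_{\mathrm{ifm}}(s)$ contains at most $N(d,s)$ points of $\Lambda$. 2. More precisely, admissible numbers for $(d,s)$ exist, and for every admissible number $\lambda^\ast(d,s)$ one can take $$N(d,s)=\left\lceil \frac{1}{\lambda^\ast(d,s)}+1\right\rceil^{d}.$$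 -/

import Mathlib

/-- The integer lattice `ℤ^d` as a subset of `ℝ^d`. -/
def intLattice (d : ℕ) : Set (Fin d → ℝ) :=
  Set.range fun (z : Fin d → ℤ) (i : Fin d) => (z i : ℝ)

/-- The lattice `Λ = s ℤ^d` as a subset of `ℝ^d`. -/
def scaledLattice (d s : ℕ) : Set (Fin d → ℝ) :=
  Set.range fun (z : Fin d → ℤ) (i : Fin d) => (s : ℝ) * (z i : ℝ)

/-- A polyhedron: the intersection of finitely many closed halfspaces `{x | a ⬝ x ≤ b}`, `a ≠ 0`
(it need not be full-dimensional, nor bounded). -/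
def IsPolyhedron {d : ℕ} (P : Set (Fin d → ℝ)) : Prop :=
  ∃ (m : ℕ) (a : Fin m → Fin d → ℝ) (b : Fin m → ℝ),
    (∀ j, a j ≠ 0) ∧ P = {x | ∀ j, ∑ i, a j i * x i ≤ b j}

/-- A polytope is a bounded polyhedron. -/
def IsPolytope {d : ℕ} (P : Set (Fin d → ℝ)) : Prop :=
  IsPolyhedron P ∧ Bornology.IsBounded P

/-- `P` is integral: it is the convex hull of its integer points. -/
def IsIntegralSet {d : ℕ} (P : Set (Fin d → ℝ)) : Prop :=
  P = convexHull ℝ (P ∩ intLattice d)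

/-- `P` is `Λ`-free for `Λ = s ℤ^d`: no point of `Λ` is interior to `P`. -/
def IsLatticeFree {d : ℕ} (s : ℕ) (P : Set (Fin d → ℝ)) : Prop :=
  interior P ∩ scaledLattice d s = ∅

/-- The class of `Λ`-free integral polyhedra in `ℝ^d`, where `Λ = s ℤ^d`. -/
def freeIntegralPolyhedra (d s : ℕ) : Set (Set (Fin d → ℝ)) :=
  {P | IsPolyhedron P ∧ IsIntegralSet P ∧ IsLatticeFree s P}

/-- The class of those `Λ`-free integral polyhedra in `ℝ^d` that are maximal, with respect to
inclusion, among all (bounded or unbounded) `Λ`-free integral polyhedra. -/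
def maximalFreeIntegralPolyhedra (d s : ℕ) : Set (Set (Fin d → ℝ)) :=
  {P | Maximal (fun Q => Q ∈ freeIntegralPolyhedra d s) P}

/-- `lam` is an admissible value of the constant `λ*(d,s)`: it is positive, and whenever
`S = conv {v 0, …, v d}` is a `d`-dimensional integral simplex in `ℝ^d` having precisely one
interior point `p` in `s ℤ^d`, every barycentric coordinate `w i` of `p` with respect to `S`
is at least `lam`. -/
def IsBarycentricBound (d s : ℕ) (lam : ℝ) : Prop :=
  0 < lam ∧
    ∀ (v : Fin (d + 1) → Fin d → ℝ) (p : Fin d → ℝ),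
      AffineIndependent ℝ v →
      IsIntegralSet (convexHull ℝ (Set.range v)) →
      interior (convexHull ℝ (Set.range v)) ∩ scaledLattice d s = {p} →
      ∀ w : Fin (d + 1) → ℝ, (∀ i, 0 ≤ w i) → ∑ i, w i = 1 → ∑ i, w i • v i = p →
        ∀ i, lam ≤ w i

/-! Suppose `P` has more than `N ^ d` points of `Λ`, with `N = ⌈1/λ + 1⌉`. By pigeonhole two of them
differ by `N s γ u` with `u` primitive and `γ ≥ 1`. The cylinder `P + ℝu` is an integral polyhedron
strictly larger than the bounded `P`, so maximality puts a point of `Λ` in its interior. This leads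
to a point of `Λ` interior to `P` (`not_isLatticeFree_of_cylinder`), a contradiction.

To find it, project along `u` by a lattice-preserving map. The two points have a common image `x'`,
and the image of `P` contains a lattice point that is a convex combination of integer points giving
`x'` positive weight. Cutting the simplex at further lattice points (`exists_rep_with_large_weight`)
ends at a simplex with vertex `x'` and a single lattice point in its relative interior, where `x'`
has weight at least `λ`. The fibre of `P` over that point then has length at least `λ N s γ > s`, so
it contains a point of `Λ` strictly between two points of `P`.

The simplices met on the way may be low-dimensional; `exists_pyramid` raises them to full dimension
without increasing the old weights. Admissible numbers exist because a weight vector with a very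
small entry can be moved, by Diophantine approximation of a limit vector, to the weights of a second
interior lattice point (`exists_lower_bound_of_rigid`). -/

/-! ### Diophantine approximation and rigid weight vectors -/

/-- Simultaneous Diophantine approximation (Dirichlet), in a qualitative form. -/
theorem exists_int_approx {ι : Type*} [Fintype ι] (x : ι → ℝ) {ε : ℝ} (hε : 0 < ε) :
    ∃ (M : ℕ) (m : ι → ℤ), 0 < M ∧ (∀ i, |(M : ℝ) * x i - m i| < ε) ∧ ∀ i, x i = 0 → m i = 0 := by
  have hK : IsCompact (Set.Icc (0 : ι → ℝ) 1) := isCompact_Icc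
  -- By compactness two multiples of `x` have nearly equal fractional parts; `M` is the difference
  -- of the two multipliers.
  obtain ⟨y, -, φ, hφ, hy⟩ := hK.tendsto_subseq (x := fun (n : ℕ) i => Int.fract ((n : ℝ) * x i))
    (fun n => ⟨fun i => Int.fract_nonneg _, fun i => (Int.fract_lt_one _).le⟩)
  obtain ⟨n, hn⟩ := Metric.cauchySeq_iff.1 hy.cauchySeq ε hε
  have hlt : φ n < φ (n + 1) := hφ (Nat.lt_succ_self n)
  refine ⟨φ (n + 1) - φ n, fun i => ⌊(φ (n + 1) : ℝ) * x i⌋ - ⌊(φ n : ℝ) * x i⌋, by omega, ?_, ?_⟩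
  · intro i
    have h := (dist_pi_lt_iff hε).1 (hn (n + 1) (by omega) n le_rfl) i
    simp only [Function.comp, Real.dist_eq, Int.fract] at h
    rw [Nat.cast_sub hlt.le]
    push_cast
    convert h using 2
    ring
  · intro i hi
    simp [hi]

theorem exists_pos_le_of_finite {ι : Type*} [Finite ι] {p : ι → ℝ → Prop}
    (h : ∀ i, ∃ l > 0, p i l) (hp : ∀ i l l', l' ≤ l → p i l → p i l') : ∃ l > 0, ∀ i, p i l := by
  choose f hf hpf using h
  have : ∀ᶠ l in nhdsWithin (0 : ℝ) (Set.Ioi 0), 0 < l ∧ ∀ i, l ≤ f i := by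
    refine (eventually_mem_nhdsWithin).and (Filter.eventually_all.2 fun i => ?_)
    exact nhdsWithin_le_nhds (Iic_mem_nhds (hf i))
  obtain ⟨l, hl, hle⟩ := this.exists
  exact ⟨l, hl, fun i => hp i _ _ (hle i) (hpf i)⟩

/-- Weight vectors that cannot be moved to another positive weight vector by adding `s` times an
integer vector and renormalising have their entries bounded below. -/
theorem exists_lower_bound_of_rigid (ι : Type*) [Fintype ι] (s : ℕ) :
    ∃ l : ℝ, 0 < l ∧ ∀ w : ι → ℝ, (∀ i, 0 < w i) → ∑ i, w i = 1 →
      (∀ m : ι → ℤ, (∀ i, 0 < w i + s * (m i - (∑ j, (m j : ℝ)) * w i)) →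
        ∀ i, (m i : ℝ) = (∑ j, (m j : ℝ)) * w i) →
      ∀ i, l ≤ w i := by
  suffices H : ∀ i₀ : ι, ∃ l : ℝ, l > 0 ∧ ∀ w : ι → ℝ, (∀ i, 0 < w i) → ∑ i, w i = 1 →
      (∀ m : ι → ℤ, (∀ i, 0 < w i + s * (m i - (∑ j, (m j : ℝ)) * w i)) →
        ∀ i, (m i : ℝ) = (∑ j, (m j : ℝ)) * w i) → l ≤ w i₀ by
    obtain ⟨l, hl, h⟩ := exists_pos_le_of_finite H
      (fun i l l' hl h w h1 h2 h3 => hl.trans (h w h1 h2 h3))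
    exact ⟨l, hl, fun w h1 h2 h3 i => h i w h1 h2 h3⟩
  intro i₀
  by_contra hcon
  push Not at hcon
  choose W hW0 hW1 hWr hWl using fun n : ℕ => hcon (1 / ((n : ℝ) + 1)) (by positivity)
  obtain ⟨x, hx, φ, hφ, hlim⟩ := (isCompact_stdSimplex ℝ ι).tendsto_subseq (x := W)
    (fun n => ⟨fun i => (hW0 n i).le, hW1 n⟩)
  have hlim' := tendsto_pi_nhds.1 hlim
  have hx0 : x i₀ = 0 := by
    refine le_antisymm ?_ (hx.1 i₀)
    refine le_of_tendsto_of_tendsto' (hlim' i₀)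
      (tendsto_one_div_add_atTop_nhds_zero_nat.comp hφ.tendsto_atTop) fun n => (hWl _).le
  -- The first bound on `ε` forces `∑ m = M`; the second keeps the coordinates with `x i ≠ 0`
  -- positive after a shift by `s ε`.
  obtain ⟨ε, hε, hεc, hεx⟩ : ∃ ε : ℝ, 0 < ε ∧ Fintype.card ι * ε < 1 ∧
      ∀ i, x i = 0 ∨ s * ε < x i := by
    have h1 : ∀ᶠ ε : ℝ in nhds (0 : ℝ), Fintype.card ι * ε < 1 := by
      have : Filter.Tendsto (fun ε : ℝ => Fintype.card ι * ε) (nhds (0 : ℝ)) (nhds ((Fintype.card ι : ℝ) * 0)) :=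
        Filter.tendsto_id.const_mul _
      exact this.eventually_lt_const (by simp)
    have h2 : ∀ᶠ ε in nhds (0 : ℝ), ∀ i, x i = 0 ∨ s * ε < x i := by
      refine Filter.eventually_all.2 fun i => ?_
      rcases (hx.1 i).eq_or_lt with h | h
      · exact Filter.Eventually.of_forall fun _ => Or.inl h.symm
      · have : Filter.Tendsto (fun ε : ℝ => (s : ℝ) * ε) (nhds 0) (nhds ((s : ℝ) * 0)) :=
          Filter.tendsto_id.const_mul _
        exact (this.eventually_lt_const (by simpa using h)).mono fun _ => Or.inr
    obtain ⟨ε, hε, h⟩ := ((eventually_mem_nhdsWithin (a := (0 : ℝ)) (s := Set.Ioi 0)).and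
      (nhdsWithin_le_nhds (h1.and h2))).exists
    exact ⟨ε, hε, h⟩
  obtain ⟨M, m, hM, hm, hm0⟩ := exists_int_approx x hε
  have hsum : ∑ j, (m j : ℝ) = M := by
    have h1 : |∑ j, ((M : ℝ) * x j - m j)| < 1 := by
      calc _ ≤ ∑ j, |(M : ℝ) * x j - m j| := Finset.abs_sum_le_sum_abs _ _
        _ ≤ ∑ j : ι, ε := Finset.sum_le_sum fun j _ => (hm j).le
        _ < 1 := by simpa using hεc
    rw [Finset.sum_sub_distrib, ← Finset.mul_sum, hx.2, mul_one] at h1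
    have h2 : |(M : ℤ) - ∑ j, m j| < 1 := by exact_mod_cast h1
    have h3 := Int.abs_lt_one_iff.1 h2
    have h4 : ∑ j, m j = (M : ℤ) := by omega
    exact_mod_cast h4
  -- Rigidity is tested with `-m`, which gives `W + s (M W - m)`. Where `x i = 0` also `m i = 0`, so
  -- the entry only grows; elsewhere it tends to a limit above `x i - s ε > 0`.
  have hev : ∀ᶠ n in Filter.atTop, ∀ i,
      0 < W (φ n) i + s * (((-m i : ℤ) : ℝ) - (∑ j, ((-m j : ℤ) : ℝ)) * W (φ n) i) := by
    refine Filter.eventually_all.2 fun i => ?_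
    simp only [Int.cast_neg, Finset.sum_neg_distrib, hsum]
    rcases hεx i with h | h
    · refine Filter.Eventually.of_forall fun n => ?_
      have := hW0 (φ n) i
      simp only [hm0 i h, Int.cast_zero, neg_zero, zero_sub, neg_mul, neg_neg]
      positivity
    · have ht : Filter.Tendsto (fun n => W (φ n) i + s * (-(m i : ℝ) - -(M : ℝ) * W (φ n) i))
          Filter.atTop (nhds (x i + s * (-(m i : ℝ) - -(M : ℝ) * x i))) :=
        (hlim' i).add (((hlim' i).const_mul _).const_sub _ |>.const_mul _)
      refine ht.eventually_const_lt ?_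
      have h1 := (abs_lt.1 (hm i)).1
      have h2 : (s : ℝ) * (-ε) ≤ s * (-(m i : ℝ) - -(M : ℝ) * x i) :=
        mul_le_mul_of_nonneg_left (by linarith) (Nat.cast_nonneg _)
      linarith
  obtain ⟨n, hn⟩ := hev.exists
  -- At `i₀` rigidity reads `0 = M * W i₀`, although both factors are positive.
  have h := hWr _ _ hn i₀
  simp only [Int.cast_neg, Finset.sum_neg_distrib, hsum, hm0 i₀ hx0, Int.cast_zero, neg_zero] at h
  have h1 := hW0 (φ n) i₀
  have h2 : (0 : ℝ) < M := by exact_mod_cast hM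
  have h3 := mul_pos h2 h1
  linarith

/-! ### Barycentric coordinates in simplices -/

theorem affineIndependent_iff_sum_smul {ι V : Type*} [Fintype ι] [AddCommGroup V] [Module ℝ V]
    {v : ι → V} : AffineIndependent ℝ v ↔
      ∀ μ : ι → ℝ, ∑ i, μ i = 0 → ∑ i, μ i • v i = 0 → ∀ i, μ i = 0 := by
  rw [affineIndependent_iff_of_fintype]
  refine forall_congr' fun μ => forall_congr' fun h => ?_
  rw [Finset.weightedVSub_eq_linear_combination _ h]

theorem AffineIndependent.eq_of_sum_smul_eq {ι V : Type*} [Fintype ι] [AddCommGroup V] [Module ℝ V]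
    {v : ι → V} (hv : AffineIndependent ℝ v) {w w' : ι → ℝ} (h : ∑ i, w i = ∑ i, w' i)
    (h' : ∑ i, w i • v i = ∑ i, w' i • v i) : w = w' := by
  funext i
  have := affineIndependent_iff_sum_smul.1 hv (w - w') (by simp [Finset.sum_sub_distrib, h])
    (by simp [sub_smul, Finset.sum_sub_distrib, h']) i
  simpa [sub_eq_zero] using this

section Simplex

variable {d : ℕ} {ι : Type*} [Fintype ι] {v : ι → Fin d → ℝ}

theorem exists_affineBasis_of_card (hv : AffineIndependent ℝ v) (hc : Fintype.card ι = d + 1) :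
    ∃ b : AffineBasis ι ℝ (Fin d → ℝ), ∀ i, b i = v i :=
  ⟨⟨v, hv, by rw [hv.affineSpan_eq_top_iff_card_eq_finrank_add_one]; simpa using hc⟩, fun _ => rfl⟩

theorem AffineBasis.coord_sum_smul (b : AffineBasis ι ℝ (Fin d → ℝ)) {w : ι → ℝ}
    (hw : ∑ i, w i = 1) (i : ι) : b.coord i (∑ j, w j • b j) = w i := by
  have := b.coord_apply_combination_of_mem (Finset.mem_univ i) hw
  rwa [Finset.affineCombination_eq_linear_combination _ _ _ hw] at this

theorem mem_interior_simplex_iff (hv : AffineIndependent ℝ v) (hc : Fintype.card ι = d + 1)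
    {x : Fin d → ℝ} : x ∈ interior (convexHull ℝ (Set.range v)) ↔
      ∃ w : ι → ℝ, (∀ i, 0 < w i) ∧ ∑ i, w i = 1 ∧ ∑ i, w i • v i = x := by
  obtain ⟨b, hb⟩ := exists_affineBasis_of_card hv hc
  obtain rfl : ⇑b = v := funext hb
  rw [b.interior_convexHull]
  constructor
  · intro h
    exact ⟨fun i => b.coord i x, h, b.sum_coord_apply_eq_one x,
      b.linear_combination_coord_eq_self x⟩
  · rintro ⟨w, h0, h1, rfl⟩ i
    rw [b.coord_sum_smul h1]
    exact h0 i

/-- If `v i` were not an integer point, every integer point of the simplex would have `i`-th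
coordinate below `1`, and so would their convex hull, which contains `v i`. -/
theorem vertex_mem_of_integral_simplex (hv : AffineIndependent ℝ v) (hc : Fintype.card ι = d + 1)
    (h : IsIntegralSet (convexHull ℝ (Set.range v))) (i : ι) : v i ∈ intLattice d := by
  classical
  obtain ⟨b, hb⟩ := exists_affineBasis_of_card hv hc
  obtain rfl : ⇑b = v := funext hb
  by_contra hi
  have hsub : convexHull ℝ (Set.range b) ∩ intLattice d ⊆ b.coord i ⁻¹' Set.Iio 1 := by
    rintro x ⟨hx, hxi⟩
    rw [b.convexHull_eq_nonneg_coord] at hx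
    by_contra hx1
    have hx1 : 1 ≤ b.coord i x := not_lt.1 hx1
    refine hi ?_
    convert hxi
    have hz : ∀ j ∈ Finset.univ.erase i, b.coord j x = 0 := by
      rw [← Finset.sum_eq_zero_iff_of_nonneg (fun j _ => hx j)]
      refine le_antisymm ?_ (Finset.sum_nonneg fun j _ => hx j)
      have := Finset.add_sum_erase Finset.univ (fun j => b.coord j x) (Finset.mem_univ i)
      rw [b.sum_coord_apply_eq_one] at this
      linarith
    refine b.ext_elem fun j => ?_
    by_cases hj : j = i
    · subst hj
      refine le_antisymm ?_ ?_
      · rw [b.coord_apply_eq]; exact hx1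
      · rw [b.coord_apply_eq, ← b.sum_coord_apply_eq_one x]
        exact Finset.single_le_sum (f := fun k => b.coord k x) (fun k _ => hx k) (Finset.mem_univ j)
    · rw [b.coord_apply_ne hj, hz j (by simp [hj])]
  have hconv : Convex ℝ (b.coord i ⁻¹' Set.Iio 1) := (convex_Iio 1).affine_preimage _
  have hmem : b i ∈ convexHull ℝ (convexHull ℝ (Set.range b) ∩ intLattice d) :=
    h ▸ subset_convexHull ℝ _ (Set.mem_range_self i)
  have := convexHull_min hsub hconv hmem
  simp at this

end Simplex

/-! ### The lattices and the existence of admissible numbers -/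

section Lattice

variable {d s : ℕ}

theorem intLattice_add {x y : Fin d → ℝ} (hx : x ∈ intLattice d) (hy : y ∈ intLattice d) :
    x + y ∈ intLattice d := by
  obtain ⟨a, rfl⟩ := hx
  obtain ⟨b, rfl⟩ := hy
  exact ⟨a + b, by ext; simp⟩

theorem intLattice_zsmul {x : Fin d → ℝ} (hx : x ∈ intLattice d) (n : ℤ) :
    (n : ℝ) • x ∈ intLattice d := by
  obtain ⟨a, rfl⟩ := hx
  exact ⟨n • a, by ext; simp⟩

theorem intLattice_sub {x y : Fin d → ℝ} (hx : x ∈ intLattice d) (hy : y ∈ intLattice d) :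
    x - y ∈ intLattice d := by
  obtain ⟨a, rfl⟩ := hx
  obtain ⟨b, rfl⟩ := hy
  exact ⟨a - b, by ext; simp⟩

theorem intLattice_sum {ι : Type*} {t : Finset ι} {x : ι → Fin d → ℝ}
    (hx : ∀ i ∈ t, x i ∈ intLattice d) : ∑ i ∈ t, x i ∈ intLattice d :=
  Finset.sum_induction _ (· ∈ intLattice d) (fun _ _ => intLattice_add) ⟨0, by ext; simp⟩ hx

theorem mem_scaledLattice_iff {x : Fin d → ℝ} :
    x ∈ scaledLattice d s ↔ ∃ y ∈ intLattice d, x = (s : ℝ) • y := by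
  constructor
  · rintro ⟨z, rfl⟩
    exact ⟨_, ⟨z, rfl⟩, by ext; simp⟩
  · rintro ⟨_, ⟨z, rfl⟩, rfl⟩
    exact ⟨z, by ext; simp⟩

theorem smul_mem_scaledLattice {x : Fin d → ℝ} (hx : x ∈ intLattice d) :
    (s : ℝ) • x ∈ scaledLattice d s :=
  mem_scaledLattice_iff.2 ⟨x, hx, rfl⟩

theorem scaledLattice_subset : scaledLattice d s ⊆ intLattice d := by
  intro x hx
  obtain ⟨y, hy, rfl⟩ := mem_scaledLattice_iff.1 hx
  exact_mod_cast intLattice_zsmul hy (s : ℤ)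

theorem scaledLattice_add {x y : Fin d → ℝ} (hx : x ∈ scaledLattice d s)
    (hy : y ∈ scaledLattice d s) : x + y ∈ scaledLattice d s := by
  obtain ⟨a, ha, rfl⟩ := mem_scaledLattice_iff.1 hx
  obtain ⟨b, hb, rfl⟩ := mem_scaledLattice_iff.1 hy
  rw [← smul_add]
  exact smul_mem_scaledLattice (intLattice_add ha hb)

/-- Uniqueness of `p` makes its weights rigid: for integers `m` with sum `M`, the point `p + s (∑ m
i • v i - M p)` is again in `Λ`, so if its weights are positive it must equal `p`. -/
theorem exists_isBarycentricBound (d : ℕ) (hs : 1 ≤ s) : ∃ lam : ℝ, IsBarycentricBound d s lam := by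
  obtain ⟨l, hl, H⟩ := exists_lower_bound_of_rigid (Fin (d + 1)) s
  refine ⟨l, hl, fun v p hv hint hp w hw0 hw1 hwp => ?_⟩
  have hc : Fintype.card (Fin (d + 1)) = d + 1 := Fintype.card_fin _
  have hpm : p ∈ interior (convexHull ℝ (Set.range v)) ∩ scaledLattice d s := by simp [hp]
  have hwpos : ∀ i, 0 < w i := by
    obtain ⟨w', h0, h1, h2⟩ := (mem_interior_simplex_iff hv hc).1 hpm.1
    rwa [hv.eq_of_sum_smul_eq (hw1.trans h1.symm) (hwp.trans h2.symm)]
  refine H w hwpos hw1 fun m hm => ?_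
  set M : ℝ := ∑ j, (m j : ℝ) with hM
  set c : Fin (d + 1) → ℝ := fun i => w i + s * (m i - M * w i) with hcdef
  have hc1 : ∑ i, c i = 1 := by
    simp only [hcdef, Finset.sum_add_distrib, ← Finset.mul_sum, Finset.sum_sub_distrib, hw1, ← hM]
    ring
  have hcv : ∑ i, c i • v i = p + (s : ℝ) • (∑ i, (m i : ℝ) • v i - M • p) := by
    rw [← hwp, Finset.smul_sum, ← Finset.sum_sub_distrib, Finset.smul_sum,
      ← Finset.sum_add_distrib]
    refine Finset.sum_congr rfl fun i _ => ?_
    simp only [hcdef]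
    module
  have hmem : ∑ i, c i • v i ∈ interior (convexHull ℝ (Set.range v)) ∩ scaledLattice d s := by
    refine ⟨(mem_interior_simplex_iff hv hc).2 ⟨c, hm, hc1, rfl⟩, ?_⟩
    rw [hcv]
    refine scaledLattice_add hpm.2 (smul_mem_scaledLattice (intLattice_sub ?_ ?_))
    · exact intLattice_sum fun i _ =>
        intLattice_zsmul (vertex_mem_of_integral_simplex hv hc hint i) _
    · have := intLattice_zsmul (scaledLattice_subset hpm.2) (∑ j, m j)
      rwa [Int.cast_sum] at this
  rw [hp, Set.mem_singleton_iff] at hmem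
  have hcw : c = w := hv.eq_of_sum_smul_eq (hc1.trans hw1.symm) (hmem.trans hwp.symm)
  intro i
  have h1 := congrFun hcw i
  have h2 : (0 : ℝ) < s := by exact_mod_cast hs
  have h3 : (s : ℝ) * (m i - M * w i) = 0 := by simp only [hcdef] at h1; linarith
  rcases mul_eq_zero.1 h3 with h | h
  · exact absurd h h2.ne'
  · linarith

end Lattice

/-! ### Primitive integer functionals -/

section Functional

variable {d s : ℕ}

/-- A nonzero integer vector is a multiple of a primitive one. -/
theorem exists_primitive {ι : Type*} [Fintype ι] {z : ι → ℤ} (hz : z ≠ 0) :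
    ∃ (γ : ℤ) (u f : ι → ℤ), 0 < γ ∧ z = γ • u ∧ ∑ i, u i * f i = 1 := by
  suffices H : ∃ (γ : ℤ) (u f : ι → ℤ), γ ≠ 0 ∧ z = γ • u ∧ ∑ i, u i * f i = 1 by
    obtain ⟨γ, u, f, hγ, h1, h2⟩ := H
    rcases hγ.lt_or_gt with h | h
    · exact ⟨-γ, -u, -f, by omega, by simp [h1], by simpa using h2⟩
    · exact ⟨γ, u, f, h, h1, h2⟩
  obtain ⟨γ, hγ⟩ := (inferInstance : (Ideal.span (Set.range z)).IsPrincipal)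
  have hdvd : ∀ i, ∃ c, z i = γ * c := fun i => by
    have : z i ∈ Ideal.span (Set.range z) := Ideal.subset_span (Set.mem_range_self i)
    rw [hγ] at this
    exact Ideal.mem_span_singleton.1 this
  choose u hu using hdvd
  have hγm : γ ∈ Ideal.span (Set.range z) := hγ ▸ Ideal.mem_span_singleton_self γ
  obtain ⟨f, hf⟩ := Ideal.mem_span_range_iff_exists_fun.1 hγm
  have hγ0 : γ ≠ 0 := by
    rintro rfl
    exact hz (funext fun i => by simp [hu i])
  refine ⟨γ, u, f, hγ0, funext fun i => by simp [hu i], ?_⟩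
  refine mul_left_cancel₀ hγ0 ?_
  rw [mul_one, Finset.mul_sum]
  conv_rhs => rw [← hf]
  exact Finset.sum_congr rfl fun i _ => by rw [hu i]; ring

/-- The linear functional `x ↦ f ⬝ x` with integer coefficients. -/
def intFunctional (f : Fin d → ℤ) : (Fin d → ℝ) →ₗ[ℝ] ℝ :=
  ∑ i, (f i : ℝ) • LinearMap.proj i

theorem intFunctional_apply (f : Fin d → ℤ) (x : Fin d → ℝ) :
    intFunctional f x = ∑ i, (f i : ℝ) * x i := by
  simp [intFunctional]

theorem intFunctional_intLattice (f : Fin d → ℤ) {x : Fin d → ℝ} (hx : x ∈ intLattice d) :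
    ∃ n : ℤ, intFunctional f x = n := by
  obtain ⟨z, rfl⟩ := hx
  exact ⟨∑ i, f i * z i, by simp [intFunctional_apply]⟩

/-- Few integer points lie on a common level set of a primitive integer functional. -/
theorem exists_primitive_functional {ι : Type*} [Fintype ι] {v : ι → Fin d → ℝ}
    (hv : ∀ i, v i ∈ intLattice d) (hc : Fintype.card ι ≤ d) (i₀ : ι) :
    ∃ (f : Fin d → ℤ) (g : Fin d → ℝ), g ∈ intLattice d ∧ intFunctional f g = 1 ∧
      ∀ i, intFunctional f (v i) = intFunctional f (v i₀) := by
  classical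
  choose z hz using hv
  let L : (Fin d → ℤ) →ₗ[ℤ] ({i // i ≠ i₀} → ℤ) :=
    LinearMap.pi fun i => ∑ k, (z i k - z i₀ k) • LinearMap.proj k
  -- There are at most `d - 1` integer linear equations in `d` unknowns.
  have hL : ¬ Function.Injective L := fun h => by
    have h1 := card_le_of_injective ℤ L h
    have h2 : Fintype.card {i // i ≠ i₀} < Fintype.card ι := Fintype.card_subtype_lt (x := i₀) (by simp)
    simp only [Fintype.card_fin] at h1
    omega
  rw [← LinearMap.ker_eq_bot, Submodule.eq_bot_iff] at hL
  push Not at hL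
  obtain ⟨f₀, hf₀, hne⟩ := hL
  obtain ⟨γ, f, g, hγ, rfl, hfg⟩ := exists_primitive hne
  refine ⟨f, fun i => (g i : ℝ), ⟨g, rfl⟩, ?_, fun i => ?_⟩
  · rw [intFunctional_apply]
    exact_mod_cast hfg
  · by_cases hi : i = i₀
    · rw [hi]
    · have h := congrFun (LinearMap.mem_ker.1 hf₀) ⟨i, hi⟩
      simp only [L, LinearMap.pi_apply, LinearMap.sum_apply, LinearMap.smul_apply,
        LinearMap.proj_apply, Pi.smul_apply, smul_eq_mul, Pi.zero_apply] at h
      have h' : γ * ∑ k, (z i k - z i₀ k) * f k = 0 := by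
        rw [Finset.mul_sum, ← h]
        exact Finset.sum_congr rfl fun k _ => by ring
      have h'' := (mul_eq_zero.1 h').resolve_left hγ.ne'
      have h3 : ∑ k, ((z i k : ℝ) - z i₀ k) * f k = 0 := by exact_mod_cast h''
      rw [intFunctional_apply, intFunctional_apply, ← sub_eq_zero, ← Finset.sum_sub_distrib, ← h3]
      refine Finset.sum_congr rfl fun k _ => ?_
      rw [← hz i, ← hz i₀]
      ring

end Functional

/-! ### Admissible numbers and lower-dimensional simplices -/

/-- The points of `s ℤ^d` in the relative interior of the simplex with vertices `v`. -/
def relLatticePoints {d : ℕ} (s : ℕ) {ι : Type*} [Fintype ι] (v : ι → Fin d → ℝ) :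
    Set (Fin d → ℝ) :=
  {p | p ∈ scaledLattice d s ∧ ∃ w : ι → ℝ, (∀ i, 0 < w i) ∧ ∑ i, w i = 1 ∧ ∑ i, w i • v i = p}

section Extension

variable {d s : ℕ}

/-- Adding an apex to a low-dimensional integral simplex that has a unique relatively interior
point in `s ℤ^d`. -/
theorem exists_pyramid (hs : 1 ≤ s) {ι : Type} [Fintype ι] {v : ι → Fin d → ℝ} {w : ι → ℝ}
    (hv : AffineIndependent ℝ v) (hint : ∀ i, v i ∈ intLattice d) (hc : Fintype.card ι ≤ d)
    (hw0 : ∀ i, 0 < w i) (hw1 : ∑ i, w i = 1) (hp : ∑ i, w i • v i ∈ scaledLattice d s)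
    (huniq : (relLatticePoints s v).Subsingleton) :
    ∃ (v' : Option ι → Fin d → ℝ) (w' : Option ι → ℝ), AffineIndependent ℝ v' ∧
      (∀ i, v' i ∈ intLattice d) ∧ (∀ i, 0 < w' i) ∧ ∑ i, w' i = 1 ∧
      ∑ i, w' i • v' i ∈ scaledLattice d s ∧ (relLatticePoints s v').Subsingleton ∧
      ∀ i, w' (some i) ≤ w i := by
  have hne : Nonempty ι := by
    by_contra h
    rw [not_nonempty_iff] at h
    simp at hw1
  obtain ⟨i₀⟩ := hne
  obtain ⟨f, g, hg, hfg, hfv⟩ := exists_primitive_functional hint hc i₀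
  set p := ∑ i, w i • v i with hpdef
  set c := intFunctional f (v i₀) with hcdef
  have hsum : ∀ μ : ι → ℝ, intFunctional f (∑ i, μ i • v i) = (∑ i, μ i) * c := fun μ => by
    simp [map_sum, hfv, Finset.sum_mul]
  have hfp : intFunctional f p = c := by rw [hpdef, hsum, hw1, one_mul]
  have hs0 : (0 : ℝ) < s := by exact_mod_cast hs
  have hs1 : (0 : ℝ) < s + 1 := by positivity
  obtain ⟨p₀, hp₀, hpp₀⟩ := mem_scaledLattice_iff.1 hp
  obtain ⟨n₀, hn₀⟩ := intFunctional_intLattice f hp₀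
  have hcn : c = s * n₀ := by rw [← hfp, hpp₀, map_smul, hn₀, smul_eq_mul]
  -- Relative to the level `c` of `p` under `f`, the base sinks to height `-1` and the apex sits at
  -- height `s` above `p`. Points of `Λ` have relative heights in `s ℤ`, so inside the pyramid only
  -- height `0` is possible.
  let v' : Option ι → Fin d → ℝ := fun o => o.elim (p + (s : ℝ) • g) (fun i => v i - g)
  have hcomb : ∀ μ : Option ι → ℝ, ∑ i, μ i • v' i =
      ∑ i, μ (some i) • v i - (∑ i, μ (some i)) • g + μ none • (p + (s : ℝ) • g) := fun μ => by
    simp only [Fintype.sum_option, v', Option.elim, smul_sub, Finset.sum_sub_distrib,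
      Finset.sum_smul]
    abel
  have hfcomb : ∀ μ : Option ι → ℝ, intFunctional f (∑ i, μ i • v' i) =
      (∑ i, μ (some i)) * (c - 1) + μ none * (c + s) := fun μ => by
    rw [hcomb, map_add, map_sub, map_smul, map_smul, map_add, map_smul, hsum, hfg, hfp]
    simp only [smul_eq_mul]
    ring
  let w' : Option ι → ℝ := fun o => o.elim (1 / (s + 1)) (fun i => s / (s + 1) * w i)
  have hw'0 : ∀ i, 0 < w' i := by
    rintro (_ | i)
    · exact one_div_pos.2 hs1
    · exact mul_pos (div_pos hs0 hs1) (hw0 i)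
  have hw'1 : ∑ i, w' i = 1 := by
    simp only [Fintype.sum_option, w', Option.elim, ← Finset.mul_sum, hw1]
    field_simp
    ring
  have hw'p : ∑ i, w' i • v' i = p := by
    rw [hcomb]
    simp only [w', Option.elim, mul_smul, ← Finset.smul_sum, ← Finset.mul_sum, hw1, ← hpdef]
    rw [← sub_eq_zero]
    have : ((s : ℝ) / (s + 1)) = 1 - 1 / (s + 1) := by field_simp; ring
    have h2 : (1 : ℝ) / (s + 1) * s = 1 - 1 / (s + 1) := by field_simp; ring
    rw [smul_add, smul_smul (1 / ((s : ℝ) + 1)), h2, this]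
    module
  refine ⟨v', w', affineIndependent_iff_sum_smul.2 ?_, ?_, hw'0, hw'1, hw'p ▸ hp, ?_, ?_⟩
  · intro μ h1 h2
    have h3 := hfcomb μ
    rw [h2, map_zero] at h3
    rw [Fintype.sum_option] at h1
    have h4 : ∑ i, μ (some i) = -μ none := by linarith
    rw [h4] at h3
    have h5 : μ none * (s + 1) = 0 := by linear_combination -h3
    have h6 : μ none = 0 := (mul_eq_zero.1 h5).resolve_right hs1.ne'
    rw [hcomb, h4, h6] at h2
    rw [h6, neg_zero] at h4
    rintro (_ | i)
    · exact h6
    · exact affineIndependent_iff_sum_smul.1 hv (fun i => μ (some i)) h4 (by simpa using h2) i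
  · rintro (_ | i)
    · exact intLattice_add (scaledLattice_subset hp) (scaledLattice_subset (smul_mem_scaledLattice hg))
    · exact intLattice_sub (hint i) hg
  · suffices H : ∀ q ∈ relLatticePoints s v', q = p from fun x hx y hy => (H x hx).trans (H y hy).symm
    rintro q ⟨hq, ω, hω0, hω1, rfl⟩
    obtain ⟨q₀, hq₀, hqq⟩ := mem_scaledLattice_iff.1 hq
    obtain ⟨n, hn⟩ := intFunctional_intLattice f hq₀
    have h1 := hfcomb ω
    rw [hqq, map_smul, hn, smul_eq_mul] at h1
    rw [Fintype.sum_option] at hω1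
    have h2 : ∑ i, ω (some i) = 1 - ω none := by linarith
    have hlt : ω none < 1 := by
      have : 0 < ∑ i, ω (some i) := Finset.sum_pos (fun i _ => hω0 _) ⟨i₀, Finset.mem_univ _⟩
      linarith
    -- Both sides are the relative height of the lattice point; the left one lies strictly between
    -- `-1` and `s`.
    have h3 : ω none * (s + 1) - 1 = s * ((n - n₀ : ℤ) : ℝ) := by
      push_cast
      rw [h2] at h1
      linear_combination -h1 - hcn
    have h4 : n - n₀ = 0 := by
      have h5 : (-1 : ℝ) < s * ((n - n₀ : ℤ) : ℝ) := by
        rw [← h3]; have := mul_pos (hω0 none) hs1; linarith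
      have h6 : (s : ℝ) * ((n - n₀ : ℤ) : ℝ) < s * 1 := by
        rw [← h3]; have := mul_lt_mul_of_pos_right hlt hs1; linarith
      have h7 : n - n₀ < 1 := by exact_mod_cast lt_of_mul_lt_mul_left h6 hs0.le
      have h8 : (-1 : ℤ) < s * (n - n₀) := by exact_mod_cast h5
      have h9 : (1 : ℤ) ≤ s := by exact_mod_cast hs
      nlinarith
    rw [h4, Int.cast_zero, mul_zero] at h3
    have hβ : ω none = 1 / (s + 1) := by
      rw [eq_div_iff hs1.ne']; linarith
    have h10 : ω none * s = 1 - ω none := by linarith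
    -- At height `0` the shifts by `g` cancel. Distributing the apex weight along `w` exhibits the
    -- point in the relative interior of the original simplex.
    have hcq : ∑ i, (ω (some i) + ω none * w i) • v i = ∑ i, ω i • v' i := by
      rw [hcomb, h2]
      simp only [add_smul, Finset.sum_add_distrib, mul_smul, ← Finset.smul_sum, ← hpdef]
      rw [smul_add, smul_smul, h10]
      abel
    have hmem : ∑ i, ω i • v' i ∈ relLatticePoints s v := by
      refine ⟨hq, fun i => ω (some i) + ω none * w i, fun i => ?_, ?_, hcq⟩
      · exact add_pos (hω0 _) (mul_pos (hω0 _) (hw0 i))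
      · rw [Finset.sum_add_distrib, ← Finset.mul_sum, hw1, h2]; ring
    exact huniq hmem ⟨hp, w, hw0, hw1, rfl⟩
  · intro i
    change s / (s + 1) * w i ≤ w i
    refine mul_le_of_le_one_left (hw0 i).le ?_
    rw [div_le_one hs1]
    linarith

/-- An admissible number also bounds the barycentric coordinates in lower-dimensional simplices. -/
theorem IsBarycentricBound.le_of_unique {lam : ℝ} (hlam : IsBarycentricBound d s lam) (hs : 1 ≤ s)
    {ι : Type} [Fintype ι] {v : ι → Fin d → ℝ} {w : ι → ℝ}
    (hv : AffineIndependent ℝ v) (hint : ∀ i, v i ∈ intLattice d)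
    (hw0 : ∀ i, 0 < w i) (hw1 : ∑ i, w i = 1) (hp : ∑ i, w i • v i ∈ scaledLattice d s)
    (huniq : (relLatticePoints s v).Subsingleton) (i : ι) : lam ≤ w i := by
  have hcard : Fintype.card ι ≤ d + 1 := by
    simpa using hv.card_le_finrank_succ.trans (Nat.succ_le_succ (Submodule.finrank_le _))
  obtain ⟨k, hk⟩ := Nat.exists_eq_add_of_le hcard
  -- Induction on the number of missing vertices; each pyramid adds one.
  induction k generalizing ι with
  | zero =>
    have hc : Fintype.card ι = d + 1 := by omega
    let e : Fin (d + 1) ≃ ι := (Fintype.equivFinOfCardEq hc).symm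
    have hr : Set.range (v ∘ e) = Set.range v := e.surjective.range_comp v
    have := hlam.2 (v ∘ e) (∑ i, w i • v i) (hv.comp_embedding e.toEmbedding) ?_ ?_ (w ∘ e)
      (fun i => (hw0 _).le) ((e.sum_comp w).trans hw1) (e.sum_comp fun i => w i • v i) (e.symm i)
    · simpa using this
    · rw [hr]
      refine (convexHull_mono ?_).antisymm
        (convexHull_min Set.inter_subset_left (convex_convexHull ℝ _))
      rintro _ ⟨j, rfl⟩
      exact ⟨subset_convexHull ℝ _ (Set.mem_range_self j), hint j⟩
    · rw [hr]
      refine Set.eq_singleton_iff_unique_mem.2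
        ⟨⟨(mem_interior_simplex_iff hv hc).2 ⟨w, hw0, hw1, rfl⟩, hp⟩, fun q hq => ?_⟩
      exact huniq ⟨hq.2, (mem_interior_simplex_iff hv hc).1 hq.1⟩ ⟨hp, w, hw0, hw1, rfl⟩
  | succ k ih =>
    obtain ⟨v', w', h1, h2, h3, h4, h5, h6, h7⟩ :=
      exists_pyramid hs hv hint (by omega) hw0 hw1 hp huniq
    have hc' : Fintype.card (Option ι) = Fintype.card ι + 1 := Fintype.card_option
    exact (ih h1 h2 h3 h4 h5 h6 (some i) (by omega) (by omega)).trans (h7 i)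

end Extension

/-! ### Carathéodory reduction and finiteness -/

theorem sum_subtype_of_eq_zero {ι M : Type*} [Fintype ι] [AddCommMonoid M] {P : ι → Prop}
    [DecidablePred P] {f : ι → M} (h : ∀ i, ¬ P i → f i = 0) :
    ∑ j : {i // P i}, f j = ∑ i, f i := by
  rw [← Finset.sum_subtype (Finset.univ.filter P) (by simp) f]
  exact Finset.sum_filter_of_ne fun i _ hi => not_not.1 (mt (h i) hi)

/-- The longest step from a positive vector in the direction `-μ` inside the orthant. -/
theorem exists_max_step {ι : Type*} [Fintype ι] {w μ : ι → ℝ} (hw : ∀ i, 0 < w i)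
    (hμ : ∃ i, 0 < μ i) : ∃ τ : ℝ, 0 < τ ∧ (∀ i, 0 ≤ w i - τ * μ i) ∧ ∃ j, 0 < μ j ∧ w j = τ * μ j := by
  obtain ⟨i₁, hi₁⟩ := hμ
  obtain ⟨j, hj, hmin⟩ := (Finset.univ.filter fun i => 0 < μ i).exists_min_image
    (fun i => w i / μ i) ⟨i₁, by simpa using hi₁⟩
  have hj0 : 0 < μ j := (Finset.mem_filter.1 hj).2
  have hτ : 0 < w j / μ j := div_pos (hw j) hj0
  refine ⟨w j / μ j, hτ, fun i => ?_, j, hj0, by field_simp⟩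
  rcases lt_or_ge 0 (μ i) with h | h
  · have := hmin i (by simpa using h)
    rw [le_div_iff₀ h] at this
    linarith
  · have := mul_nonpos_of_nonneg_of_nonpos hτ.le h
    linarith [hw i]

/-- Carathéodory's theorem, keeping a prescribed point with positive weight. -/
theorem exists_affineIndependent_rep {V : Type*} [AddCommGroup V] [Module ℝ V] {ι : Type}
    [Fintype ι] (v : ι → V) (w : ι → ℝ) (i₀ : ι) (hw0 : ∀ i, 0 < w i) (hw1 : ∑ i, w i = 1) :
    ∃ (κ : Type) (_ : Fintype κ) (e : κ → ι) (w' : κ → ℝ) (k₀ : κ), e k₀ = i₀ ∧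
      AffineIndependent ℝ (v ∘ e) ∧ (∀ k, 0 < w' k) ∧ ∑ k, w' k = 1 ∧
      ∑ k, w' k • v (e k) = ∑ i, w i • v i := by
  classical
  induction hn : Fintype.card ι using Nat.strong_induction_on generalizing ι with
  | _ n ih =>
    by_cases hv : AffineIndependent ℝ v
    · exact ⟨ι, inferInstance, id, w, i₀, rfl, hv, hw0, hw1, rfl⟩
    -- The sign of the dependence is chosen so that subtracting `τ * μ` cannot lower the weight at
    -- `i₀`.
    obtain ⟨μ, hμ0, hμv, hμi, hμne⟩ : ∃ μ : ι → ℝ, ∑ i, μ i = 0 ∧ ∑ i, μ i • v i = 0 ∧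
        μ i₀ ≤ 0 ∧ ∃ i, μ i ≠ 0 := by
      rw [affineIndependent_iff_sum_smul] at hv
      push Not at hv
      obtain ⟨μ, h1, h2, i, h3⟩ := hv
      rcases le_total (μ i₀) 0 with h | h
      · exact ⟨μ, h1, h2, h, i, h3⟩
      · exact ⟨-μ, by simp [h1], by simp [h2], by simpa using h, i, by simpa using h3⟩
    have hpos : ∃ i, 0 < μ i := by
      by_contra hcon
      push Not at hcon
      obtain ⟨i, hi⟩ := hμne
      exact hi ((Finset.sum_eq_zero_iff_of_nonpos fun j _ => hcon j).1 hμ0 i (Finset.mem_univ i))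
    obtain ⟨τ, hτ, hnn, j, hj, hjτ⟩ := exists_max_step hw0 hpos
    let c : ι → ℝ := fun i => w i - τ * μ i
    have hc0 : ∀ i, ¬ 0 < c i → c i = 0 := fun i hi => le_antisymm (not_lt.1 hi) (hnn i)
    have hi₀ : 0 < c i₀ := by
      have := mul_nonpos_of_nonneg_of_nonpos hτ.le hμi
      have := hw0 i₀
      simp only [c]; linarith
    have hcard : Fintype.card {i // 0 < c i} < n := by
      rw [← hn]
      exact Fintype.card_subtype_lt (x := j) (by simp [c, hjτ])
    have hsum1 : ∑ k : {i // 0 < c i}, c k = 1 := by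
      rw [sum_subtype_of_eq_zero hc0]
      simp [c, Finset.sum_sub_distrib, ← Finset.mul_sum, hμ0, hw1]
    have hsumv : ∑ k : {i // 0 < c i}, c k • v k = ∑ i, w i • v i := by
      rw [sum_subtype_of_eq_zero (f := fun i => c i • v i) fun i hi => by simp [hc0 i hi]]
      simp [c, sub_smul, Finset.sum_sub_distrib, mul_smul, ← Finset.smul_sum, hμv]
    obtain ⟨κ, hκ, e, w', k₀, h1, h2, h3, h4, h5⟩ := ih _ hcard
      (fun k : {i // 0 < c i} => v k) (fun k => c k) ⟨i₀, hi₀⟩ (fun k => k.2) hsum1 rfl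
    exact ⟨κ, hκ, fun k => e k, w', k₀, by simp [h1], h2, h3, h4, h5.trans hsumv⟩

theorem finite_intLattice_inter {d : ℕ} {K : Set (Fin d → ℝ)} (hK : Bornology.IsBounded K) :
    (K ∩ intLattice d).Finite := by
  obtain ⟨R, hR⟩ := hK.subset_closedBall 0
  refine ((Set.finite_Icc (fun _ : Fin d => -⌈R⌉) (fun _ => ⌈R⌉)).image
    fun (z : Fin d → ℤ) (i : Fin d) => (z i : ℝ)).subset ?_
  rintro _ ⟨hx, z, rfl⟩
  refine ⟨z, ?_, rfl⟩
  have h1 := mem_closedBall_zero_iff.1 (hR hx)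
  have h2 : ∀ i, |z i| ≤ ⌈R⌉ := fun i => by
    have h3 := (norm_le_pi_norm (fun i : Fin d => (z i : ℝ)) i).trans (h1.trans (Int.le_ceil R))
    rw [Real.norm_eq_abs] at h3
    exact_mod_cast h3
  exact ⟨fun i => (abs_le.1 (h2 i)).1, fun i => (abs_le.1 (h2 i)).2⟩

/-! ### Descent to a simplex with one relatively interior lattice point -/

section Descent

variable {d s : ℕ} {J : Type*} {ℓ : J → (Fin d → ℝ) →ₗ[ℝ] ℝ} {b : J → ℝ}

theorem functional_combo_lt {ι : Type*} [Fintype ι] {v : ι → Fin d → ℝ} {q : Fin d → ℝ} {τ : ℝ}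
    {c : ι → ℝ} (hq : ∀ j, ℓ j q < b j) (hv : ∀ i j, ℓ j (v i) ≤ b j) (hτ : 0 < τ)
    (hc : ∀ i, 0 ≤ c i) (hsum : τ + ∑ i, c i = 1) (j : J) :
    ℓ j (τ • q + ∑ i, c i • v i) < b j := by
  have h1 : τ * ℓ j q < τ * b j := mul_lt_mul_of_pos_left (hq j) hτ
  have h2 : ∑ i, c i * ℓ j (v i) ≤ ∑ i, c i * b j :=
    Finset.sum_le_sum fun i _ => mul_le_mul_of_nonneg_left (hv i j) (hc i)
  rw [← Finset.sum_mul] at h2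
  have h3 : τ * b j + (∑ i, c i) * b j = b j := by rw [← add_mul, hsum, one_mul]
  simp only [map_add, map_smul, map_sum, smul_eq_mul]
  linarith

/-- Cutting an integral simplex at a second lattice point of its relative interior. -/
theorem exists_smaller_simplex {ι : Type} [Fintype ι] {v : ι → Fin d → ℝ} {w₁ w₂ : ι → ℝ} {i₀ : ι}
    (hv : AffineIndependent ℝ v) (h10 : ∀ i, 0 < w₁ i) (h11 : ∑ i, w₁ i = 1)
    (h20 : ∀ i, 0 < w₂ i) (h21 : ∑ i, w₂ i = 1) (hne : w₁ ≠ w₂) (hle : w₂ i₀ ≤ w₁ i₀)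
    (h2l : ∑ i, w₂ i • v i ∈ scaledLattice d s) (hfin : (relLatticePoints s v).Finite) :
    ∃ (κ : Type) (_ : Fintype κ) (v' : κ → Fin d → ℝ) (w' : κ → ℝ) (k₀ : κ), v' k₀ = v i₀ ∧
      AffineIndependent ℝ v' ∧ (∀ k, v' k ∈ insert (∑ i, w₂ i • v i) (Set.range v)) ∧
      (∀ k, 0 < w' k) ∧ ∑ k, w' k = 1 ∧ ∑ k, w' k • v' k = ∑ i, w₁ i • v i ∧
      (relLatticePoints s v').ncard < (relLatticePoints s v).ncard := by
  classical
  -- The ray from `q` through the first point leaves the simplex in a face omitting `v j`; the first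
  -- point is `τ • q` plus a combination of the vertices of that face.
  obtain ⟨τ, hτ, hnn, j, -, hjτ⟩ := exists_max_step (μ := w₂) h10 ⟨i₀, h20 i₀⟩
  set q := ∑ i, w₂ i • v i with hq
  let c : ι → ℝ := fun i => w₁ i - τ * w₂ i
  have hc0 : ∀ i, ¬ 0 < c i → c i = 0 := fun i hi => le_antisymm (not_lt.1 hi) (hnn i)
  have hcsum : ∑ i, c i = 1 - τ := by
    simp [c, Finset.sum_sub_distrib, ← Finset.mul_sum, h11, h21]
  have hτ1 : τ < 1 := by
    have h1 : 0 ≤ ∑ i, c i := Finset.sum_nonneg fun i _ => hnn i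
    refine lt_of_le_of_ne (by linarith) fun h => hne (funext fun i => ?_)
    rw [h, sub_self] at hcsum
    have := (Finset.sum_eq_zero_iff_of_nonneg fun i _ => hnn i).1 hcsum i (Finset.mem_univ i)
    rw [h, one_mul] at this
    linarith
  -- The vertex `i₀` survives the cut: `τ < 1` and `w₂ i₀ ≤ w₁ i₀`.
  have hi₀ : 0 < c i₀ := by
    have := mul_lt_mul_of_pos_right hτ1 (h20 i₀)
    simp only [c]; linarith
  have hj : ¬ 0 < c j := by simp [c, hjτ]
  let v' : Option {i // 0 < c i} → Fin d → ℝ := fun o => o.elim q fun i => v i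
  let w' : Option {i // 0 < c i} → ℝ := fun o => o.elim τ fun i => c i
  -- `E` converts weights on the new vertices into weights on the old ones by expanding `q` through
  -- `w₂`.
  let E : (Option {i // 0 < c i} → ℝ) → ι → ℝ := fun μ i =>
    (if h : 0 < c i then μ (some ⟨i, h⟩) else 0) + μ none * w₂ i
  have hE1 : ∀ μ, ∑ i, E μ i = ∑ k, μ k := fun μ => by
    simp only [E, Finset.sum_add_distrib, ← Finset.mul_sum, h21, mul_one, Fintype.sum_option]
    rw [← sum_subtype_of_eq_zero (P := fun i => 0 < c i) (fun i hi => by simp [hi]), add_comm]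
    congr 1
    exact Finset.sum_congr rfl fun k _ => by simp [k.2]
  have hEv : ∀ μ, ∑ i, E μ i • v i = ∑ k, μ k • v' k := fun μ => by
    simp only [E, add_smul, Finset.sum_add_distrib, mul_smul, ← Finset.smul_sum,
      Fintype.sum_option, v', Option.elim, ← hq]
    rw [← sum_subtype_of_eq_zero (P := fun i => 0 < c i) (fun i hi => by simp [hi]), add_comm]
    congr 1
    exact Finset.sum_congr rfl fun k _ => by simp [k.2]
  have hEj : ∀ μ, E μ j = μ none * w₂ j := fun μ => by simp [E, hj]
  have hEk : ∀ μ, μ none = 0 → ∀ k : {i // 0 < c i}, E μ k = μ (some k) := fun μ h k => by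
    simp [E, h, k.2]
  have hEpos : ∀ μ, (∀ k, 0 < μ k) → ∀ i, 0 < E μ i := fun μ h i => by
    simp only [E]
    refine add_pos_of_nonneg_of_pos ?_ (mul_pos (h none) (h20 i))
    split_ifs with hi
    · exact (h _).le
    · exact le_rfl
  refine ⟨_, inferInstance, v', w', some ⟨i₀, hi₀⟩, rfl, ?_, ?_, ?_, ?_, ?_, ?_⟩
  · rw [affineIndependent_iff_sum_smul]
    intro μ h1 h2
    have h3 := affineIndependent_iff_sum_smul.1 hv (E μ) ((hE1 μ).trans h1) ((hEv μ).trans h2)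
    have h4 : μ none = 0 := by
      have := h3 j
      rw [hEj] at this
      exact (mul_eq_zero.1 this).resolve_right (h20 j).ne'
    rintro (_ | k)
    · exact h4
    · rw [← hEk μ h4 k]
      exact h3 k
  · rintro (_ | k)
    · exact Set.mem_insert _ _
    · exact Set.mem_insert_of_mem _ (Set.mem_range_self _)
  · rintro (_ | k)
    · exact hτ
    · exact k.2
  · simp only [Fintype.sum_option, w', Option.elim]
    rw [sum_subtype_of_eq_zero hc0, hcsum]
    ring
  · simp only [Fintype.sum_option, w', v', Option.elim]
    rw [sum_subtype_of_eq_zero (f := fun i => c i • v i) fun i hi => by simp [hc0 i hi]]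
    simp only [c, sub_smul, Finset.sum_sub_distrib, mul_smul, ← Finset.smul_sum, ← hq]
    abel
  -- Since `q` has positive old weights, the new relative interior lies in the old one. It misses
  -- `q`, which is now a vertex, so the count drops.
  · refine Set.ncard_lt_ncard ⟨?_, fun h => ?_⟩ hfin
    · rintro _ ⟨hp, ω, h0, h1, rfl⟩
      exact ⟨hp, E ω, hEpos ω h0, (hE1 ω).trans h1, hEv ω⟩
    · obtain ⟨-, ω, h0, h1, h2⟩ := h ⟨h2l, w₂, h20, h21, rfl⟩
      have h3 : E ω = w₂ := hv.eq_of_sum_smul_eq ((hE1 ω).trans (h1.trans h21.symm))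
        ((hEv ω).trans (h2.trans hq))
      have h4 := congrFun h3 j
      rw [hEj] at h4
      have h5 : ω none = 1 := mul_right_cancel₀ (h20 j).ne' (h4.trans (one_mul _).symm)
      rw [Fintype.sum_option, h5] at h1
      have h6 : 0 < ∑ k, ω (some k) :=
        Finset.sum_pos (fun k _ => h0 _) ⟨⟨i₀, hi₀⟩, Finset.mem_univ _⟩
      linarith

/-- A lattice point that is a convex combination using the vertex `x` with positive weight can be
exchanged for one with weight at least `lam`. -/
theorem exists_rep_with_large_weight {lam : ℝ} (hlam : IsBarycentricBound d s lam) (hs : 1 ≤ s)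
    {K : Set (Fin d → ℝ)} (hK : Convex ℝ K) (hKb : Bornology.IsBounded K)
    (hKℓ : ∀ z ∈ K, ∀ j, ℓ j z ≤ b j) {ι : Type} [Fintype ι] (v : ι → Fin d → ℝ) (w : ι → ℝ)
    (i₀ : ι) (hint : ∀ i, v i ∈ intLattice d) (hvK : ∀ i, v i ∈ K) (hw0 : ∀ i, 0 < w i)
    (hw1 : ∑ i, w i = 1) (hq : ∑ i, w i • v i ∈ scaledLattice d s)
    (hqℓ : ∀ j, ℓ j (∑ i, w i • v i) < b j) :
    ∃ (κ : Type) (_ : Fintype κ) (v' : κ → Fin d → ℝ) (w' : κ → ℝ) (k₀ : κ), v' k₀ = v i₀ ∧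
      (∀ k, v' k ∈ K) ∧ (∀ k, 0 < w' k) ∧ ∑ k, w' k = 1 ∧
      ∑ k, w' k • v' k ∈ scaledLattice d s ∧ (∀ j, ℓ j (∑ k, w' k • v' k) < b j) ∧
      lam ≤ w' k₀ := by
  suffices H : ∀ (n : ℕ) (κ : Type) (_ : Fintype κ) (v' : κ → Fin d → ℝ) (w' : κ → ℝ) (k₀ : κ),
      v' k₀ = v i₀ → AffineIndependent ℝ v' → (∀ k, v' k ∈ intLattice d) → (∀ k, v' k ∈ K) →
      (∀ k, 0 < w' k) → ∑ k, w' k = 1 → ∑ k, w' k • v' k ∈ scaledLattice d s →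
      (∀ j, ℓ j (∑ k, w' k • v' k) < b j) → (relLatticePoints s v').ncard = n →
      ∃ (κ : Type) (_ : Fintype κ) (v' : κ → Fin d → ℝ) (w' : κ → ℝ) (k₀ : κ), v' k₀ = v i₀ ∧
      (∀ k, v' k ∈ K) ∧ (∀ k, 0 < w' k) ∧ ∑ k, w' k = 1 ∧
      ∑ k, w' k • v' k ∈ scaledLattice d s ∧ (∀ j, ℓ j (∑ k, w' k • v' k) < b j) ∧
      lam ≤ w' k₀ by
    obtain ⟨κ, hκ, e, w', k₀, h1, h2, h3, h4, h5⟩ := exists_affineIndependent_rep v w i₀ hw0 hw1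
    refine H _ κ hκ (v ∘ e) w' k₀ (by simp [h1]) h2 (fun k => hint _) (fun k => hvK _) h3 h4 ?_ ?_ rfl
    · simpa [h5] using hq
    · simpa [h5] using hqℓ
  intro n
  induction n using Nat.strong_induction_on with
  | _ n ih =>
    intro κ _ v w k₀ hk₀ hv hint hvK hw0 hw1 hq hqℓ hn
    by_cases huniq : (relLatticePoints s v).Subsingleton
    · exact ⟨κ, inferInstance, v, w, k₀, hk₀, hvK, hw0, hw1, hq, hqℓ,
        hlam.le_of_unique hs hv hint hw0 hw1 hq huniq k₀⟩
    obtain ⟨w₁, w₂, h10, h11, h1l, h20, h21, h2l, hne, hle⟩ : ∃ w₁ w₂ : κ → ℝ, (∀ i, 0 < w₁ i) ∧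
        ∑ i, w₁ i = 1 ∧ ∑ i, w₁ i • v i ∈ scaledLattice d s ∧ (∀ i, 0 < w₂ i) ∧
        ∑ i, w₂ i = 1 ∧ ∑ i, w₂ i • v i ∈ scaledLattice d s ∧ w₁ ≠ w₂ ∧ w₂ k₀ ≤ w₁ k₀ := by
      rw [Set.not_subsingleton_iff] at huniq
      obtain ⟨_, ⟨hp, w₁, h10, h11, rfl⟩, _, ⟨hp', w₂, h20, h21, rfl⟩, hne⟩ := huniq
      have hne' : w₁ ≠ w₂ := fun h => hne (by rw [h])
      rcases le_total (w₂ k₀) (w₁ k₀) with h | h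
      · exact ⟨w₁, w₂, h10, h11, hp, h20, h21, hp', hne', h⟩
      · exact ⟨w₂, w₁, h20, h21, hp', h10, h11, hp, hne'.symm, h⟩
    have hfin : (relLatticePoints s v).Finite := by
      refine (finite_intLattice_inter hKb).subset ?_
      rintro _ ⟨hp, ω, h0, h1, rfl⟩
      exact ⟨hK.sum_mem (fun i _ => (h0 i).le) h1 fun i _ => hvK i, scaledLattice_subset hp⟩
    -- Strictness passes between relatively interior points: the new one is a convex combination of
    -- points of `K` giving the old one positive weight.
    have hGℓ : ∀ j, ℓ j (∑ i, w₁ i • v i) < b j := by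
      obtain ⟨τ, hτ, hnn, -⟩ := exists_max_step (μ := w) h10 ⟨k₀, hw0 k₀⟩
      have h := functional_combo_lt hqℓ (fun i j => hKℓ _ (hvK i) j) hτ hnn
        (by simp [Finset.sum_sub_distrib, ← Finset.mul_sum, h11, hw1])
      intro j
      convert h j using 2
      simp [sub_smul, Finset.sum_sub_distrib, mul_smul, ← Finset.smul_sum]
    obtain ⟨κ', hκ', v', w', k₀', h1, h2, h3, h4, h5, h6, h7⟩ :=
      exists_smaller_simplex hv h10 h11 h20 h21 hne hle h2l hfin
    refine ih _ (hn ▸ h7) κ' hκ' v' w' k₀' (h1.trans hk₀) h2 (fun k => ?_) (fun k => ?_) h4 h5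
      (h6 ▸ h1l) (h6 ▸ hGℓ) rfl
    · rcases h3 k with h | ⟨i, h⟩
      · exact h ▸ scaledLattice_subset h2l
      · exact h ▸ hint i
    · rcases h3 k with h | ⟨i, h⟩
      · exact h ▸ hK.sum_mem (fun i _ => (h20 i).le) h21 fun i _ => hvK i
      · exact h ▸ hvK i

end Descent

/-! ### Cylinders over integral polyhedra -/

section Cylinder

variable {d : ℕ}

theorem exists_between_finite {ι : Type*} [Finite ι] (A B : Set ι) (L U : ι → ℝ)
    (h : ∀ k ∈ A, ∀ j ∈ B, L k ≤ U j) : ∃ t, (∀ k ∈ A, L k ≤ t) ∧ ∀ j ∈ B, t ≤ U j := by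
  rcases A.eq_empty_or_nonempty with rfl | hA
  · rcases B.eq_empty_or_nonempty with rfl | hB
    · exact ⟨0, by simp, by simp⟩
    · obtain ⟨j, -, hj⟩ := Set.exists_min_image B U B.toFinite hB
      exact ⟨U j, by simp, hj⟩
  · obtain ⟨k, hk, hk'⟩ := Set.exists_max_image A L A.toFinite hA
    exact ⟨L k, hk', h k hk⟩

/-- Trivial inequalities in the description of a nonempty polyhedron can be discarded. -/
theorem isPolyhedron_of_finite {κ : Type*} [Finite κ] (a : κ → Fin d → ℝ) (b : κ → ℝ)
    {Q : Set (Fin d → ℝ)} (hQ : Q = {x | ∀ k, ∑ i, a k i * x i ≤ b k}) (hne : Q.Nonempty) :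
    IsPolyhedron Q := by
  obtain ⟨m, ⟨e⟩⟩ := Finite.exists_equiv_fin {k // a k ≠ 0}
  refine ⟨m, fun j => a (e.symm j), fun j => b (e.symm j), fun j => (e.symm j).2, ?_⟩
  obtain ⟨y, hy⟩ := hne
  rw [hQ] at hy ⊢
  ext x
  refine ⟨fun hx j => hx _, fun hx k => ?_⟩
  by_cases hk : a k = 0
  · simpa [hk] using hy k
  · simpa using hx (e ⟨k, hk⟩)

/-- The cylinder `P + ℝ u`. -/
def cylinder (P : Set (Fin d → ℝ)) (u : Fin d → ℝ) : Set (Fin d → ℝ) :=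
  {x | ∃ t : ℝ, x + t • u ∈ P}

theorem subset_cylinder (P : Set (Fin d → ℝ)) (u : Fin d → ℝ) : P ⊆ cylinder P u :=
  fun x hx => ⟨0, by simpa using hx⟩

theorem add_smul_mem_cylinder {P : Set (Fin d → ℝ)} {u x : Fin d → ℝ} (hx : x ∈ P) (t : ℝ) :
    x + t • u ∈ cylinder P u :=
  ⟨-t, by simpa using hx⟩

/-- Fourier–Motzkin elimination along a direction. -/
theorem IsPolyhedron.cylinder {P : Set (Fin d → ℝ)} (hP : IsPolyhedron P) (hne : P.Nonempty)
    (u : Fin d → ℝ) : IsPolyhedron (cylinder P u) := by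
  obtain ⟨m, a, b, -, rfl⟩ := hP
  let A : Fin m → (Fin d → ℝ) → ℝ := fun j x => ∑ i, a j i * x i
  have hA : ∀ j x (t : ℝ), A j (x + t • u) = A j x + t * A j u := fun j x t => by
    simp only [A, Pi.add_apply, Pi.smul_apply, smul_eq_mul, mul_add, Finset.sum_add_distrib,
      Finset.mul_sum]
    congr 1
    exact Finset.sum_congr rfl fun i _ => by ring
  refine isPolyhedron_of_finite
    -- Inequalities constant along `u` are kept; each pair with opposite signs on `u` is combined to
    -- eliminate `t`.
    (κ := {j // A j u = 0} ⊕ {p : Fin m × Fin m // 0 < A p.1 u ∧ A p.2 u < 0})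
    (Sum.elim (fun j => a j) fun p => (-A p.1.2 u) • a p.1.1 + A p.1.1 u • a p.1.2)
    (Sum.elim (fun j => b j) fun p => (-A p.1.2 u) * b p.1.1 + A p.1.1 u * b p.1.2) ?_
    (hne.mono (subset_cylinder _ u))
  have hpair : ∀ (r r' : ℝ) (j k : Fin m) (x : Fin d → ℝ),
      ∑ i, (r • a j + r' • a k) i * x i = r * A j x + r' * A k x := fun r r' j k x => by
    simp only [A, Pi.add_apply, Pi.smul_apply, smul_eq_mul, add_mul, Finset.sum_add_distrib,
      Finset.mul_sum, mul_assoc]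
  ext x
  simp only [_root_.cylinder, Set.mem_ofPred_eq, Sum.forall, Sum.elim_inl, Sum.elim_inr, hpair]
  change (∃ t : ℝ, ∀ j, A j (x + t • u) ≤ b j) ↔ (∀ j : {j // A j u = 0}, A j x ≤ b j) ∧ _
  simp only [hA]
  constructor
  · rintro ⟨t, ht⟩
    refine ⟨fun j => by simpa [j.2] using ht j, fun p => ?_⟩
    have h1 := mul_le_mul_of_nonneg_left (ht p.1.1) (neg_nonneg.2 p.2.2.le)
    have h2 := mul_le_mul_of_nonneg_left (ht p.1.2) p.2.1.le
    linarith
  · rintro ⟨h0, hp⟩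
    obtain ⟨t, ht1, ht2⟩ := exists_between_finite {k | A k u < 0} {j | 0 < A j u}
      (fun k => (b k - A k x) / A k u) (fun j => (b j - A j x) / A j u) (fun k hk j hj => by
        have := hp ⟨(j, k), hj, hk⟩
        simp only at this
        rw [div_le_iff_of_neg hk, div_mul_eq_mul_div, div_le_iff₀ hj]
        linarith)
    refine ⟨t, fun j => ?_⟩
    rcases lt_trichotomy (A j u) 0 with h | h | h
    · have := ht1 j h
      rw [div_le_iff_of_neg h] at this
      linarith
    · simpa [h] using h0 ⟨j, h⟩
    · have := ht2 j h
      rw [le_div_iff₀ h] at this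
      linarith

theorem IsIntegralSet.convex {P : Set (Fin d → ℝ)} (hP : IsIntegralSet P) : Convex ℝ P := by
  rw [hP]; exact convex_convexHull ℝ _

theorem convex_cylinder {P : Set (Fin d → ℝ)} (hP : Convex ℝ P) (u : Fin d → ℝ) :
    Convex ℝ (cylinder P u) := by
  rintro x ⟨t, hx⟩ y ⟨t', hy⟩ α β hα hβ hαβ
  refine ⟨α * t + β * t', ?_⟩
  convert hP hx hy hα hβ hαβ using 1
  module

theorem IsIntegralSet.cylinder {P : Set (Fin d → ℝ)} (hP : IsIntegralSet P) {u : Fin d → ℝ}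
    (hu : u ∈ intLattice d) : IsIntegralSet (cylinder P u) := by
  refine Set.Subset.antisymm ?_
    (convexHull_min Set.inter_subset_left (convex_cylinder hP.convex u))
  rintro x ⟨t, hx⟩
  set C := convexHull ℝ (_root_.cylinder P u ∩ intLattice d) with hC
  have hCc : Convex ℝ C := convex_convexHull ℝ _
  have hsub : P ∩ intLattice d ⊆ (fun p => p + (-t) • u) ⁻¹' C := by
    rintro p ⟨hp, hpi⟩
    have hmem : ∀ n : ℤ, p + (n : ℝ) • u ∈ C := fun n =>
      subset_convexHull ℝ _ ⟨add_smul_mem_cylinder hp _, intLattice_add hpi (intLattice_zsmul hu n)⟩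
    -- A real translate along `u` of an integer point lies between two consecutive integer
    -- translates.
    have h := hCc (hmem ⌊-t⌋) (hmem (⌊-t⌋ + 1)) (sub_nonneg.2 (Int.fract_lt_one (-t)).le)
      (Int.fract_nonneg (-t)) (by ring)
    change p + (-t) • u ∈ C
    convert h using 1
    have ht : -t = ⌊-t⌋ + Int.fract (-t) := (Int.floor_add_fract _).symm
    push_cast
    nth_rewrite 1 [ht]
    module
  rw [hP] at hx
  have := convexHull_min hsub (hCc.translate_preimage_left _) hx
  simpa using this

end Cylinder

/-! ### Lifting a lattice point and the final count -/

section Bound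

variable {d s : ℕ}

/-- A set of lattice points with more than `N ^ d` elements contains two points that are congruent
modulo `N`. -/
theorem exists_congruent_of_encard_lt {N : ℕ} (hN : 0 < N) {S : Set (Fin d → ℝ)}
    (hS : S ⊆ scaledLattice d s) (hcard : ((N ^ d : ℕ) : ℕ∞) < S.encard) :
    ∃ x ∈ S, ∃ z : Fin d → ℤ, z ≠ 0 ∧ x + ((N * s : ℕ) : ℝ) • (fun i => (z i : ℝ)) ∈ S := by
  have : NeZero N := ⟨hN.ne'⟩
  set g : (Fin d → ℤ) → Fin d → ℝ := fun z i => (s : ℝ) * (z i : ℝ) with hg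
  set T : Set (Fin d → ℤ) := g ⁻¹' S with hT
  have hST : S = g '' T := (Set.image_preimage_eq_of_subset hS).symm
  let r : (Fin d → ℤ) → Fin d → ZMod N := fun z i => (z i : ZMod N)
  have hinj : ¬ Set.InjOn r T := fun h => by
    have h1 : T.encard ≤ (N ^ d : ℕ) := by
      rw [← h.encard_image]
      refine (Set.encard_le_encard (Set.subset_univ _)).trans ?_
      rw [Set.encard_univ, ENat.card_eq_coe_fintype_card]
      simp [ZMod.card]
    rw [hST] at hcard
    exact absurd hcard (not_lt.2 ((Set.encard_image_le _ _).trans h1))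
  simp only [Set.InjOn] at hinj
  push Not at hinj
  obtain ⟨z₁, h₁, z₂, h₂, heq, hne⟩ := hinj
  have hdvd : ∀ i, ∃ c, z₂ i - z₁ i = N * c := fun i =>
    (ZMod.intCast_eq_intCast_iff_dvd_sub _ _ N).1 (congrFun heq i)
  choose z hz using hdvd
  refine ⟨g z₁, h₁, z, ?_, ?_⟩
  · rintro rfl
    refine hne (funext fun i => ?_)
    have := hz i
    simp only [Pi.zero_apply, mul_zero] at this
    omega
  · convert (show g z₂ ∈ S from h₂) using 1
    ext i
    have : (z₂ i : ℝ) = z₁ i + N * z i := by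
      have := hz i
      have h3 : z₂ i = z₁ i + N * z i := by linarith
      exact_mod_cast h3
    simp only [hg, Pi.add_apply, Pi.smul_apply, smul_eq_mul, this, Nat.cast_mul]
    ring

/-- The linear functional `x ↦ a ⬝ x`. -/
def dotFunctional (a : Fin d → ℝ) : (Fin d → ℝ) →ₗ[ℝ] ℝ :=
  ∑ i, a i • LinearMap.proj i

theorem dotFunctional_apply (a x : Fin d → ℝ) : dotFunctional a x = ∑ i, a i * x i := by
  simp [dotFunctional]

theorem dotFunctional_self_pos {a : Fin d → ℝ} (ha : a ≠ 0) : 0 < dotFunctional a a := by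
  rw [dotFunctional_apply]
  obtain ⟨i, hi⟩ := Function.ne_iff.1 ha
  exact Finset.sum_pos' (fun j _ => mul_self_nonneg _) ⟨i, Finset.mem_univ _, mul_self_pos.2 hi⟩

theorem exists_pos_add_smul_mem {U : Set (Fin d → ℝ)} {q : Fin d → ℝ} (hq : q ∈ interior U)
    (y : Fin d → ℝ) : ∃ ε : ℝ, 0 < ε ∧ q + ε • y ∈ U := by
  have hc : Filter.Tendsto (fun ε : ℝ => q + ε • y) (nhds 0) (nhds q) := by
    have : Continuous fun ε : ℝ => q + ε • y := by fun_prop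
    simpa using this.tendsto 0
  obtain ⟨ε, hε, h⟩ := ((eventually_mem_nhdsWithin (a := (0 : ℝ)) (s := Set.Ioi 0)).and
    (nhdsWithin_le_nhds (hc (mem_interior_iff_mem_nhds.1 hq)))).exists
  exact ⟨ε, hε, h⟩

theorem mem_interior_of_forall_lt {m : ℕ} {a : Fin m → Fin d → ℝ} {b : Fin m → ℝ}
    {z : Fin d → ℝ} (hz : ∀ j, dotFunctional (a j) z < b j) :
    z ∈ interior {x | ∀ j, ∑ i, a j i * x i ≤ b j} := by
  refine mem_interior.2 ⟨⋂ j, {x | dotFunctional (a j) x < b j}, fun x hx j => ?_,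
    isOpen_iInter_of_finite fun j => isOpen_lt
      (LinearMap.continuous_of_finiteDimensional _) continuous_const, Set.mem_iInter.2 hz⟩
  rw [← dotFunctional_apply]
  exact (Set.mem_iInter.1 hx j).le

/-- A bounded nonempty set is not a cylinder. -/
theorem not_cylinder_subset {P : Set (Fin d → ℝ)} (hP : Bornology.IsBounded P) {x u : Fin d → ℝ}
    (hx : x ∈ P) (hu : u ≠ 0) : ¬ cylinder P u ⊆ P := fun h => by
  obtain ⟨R, hR⟩ := hP.subset_closedBall 0
  have hu' : 0 < ‖u‖ := norm_pos_iff.2 hu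
  have h1 := mem_closedBall_zero_iff.1 (hR (h (add_smul_mem_cylinder hx ((R + ‖x‖ + 1) / ‖u‖))))
  have hR0 : 0 ≤ R := (norm_nonneg _).trans h1
  have h2 : ‖((R + ‖x‖ + 1) / ‖u‖) • u‖ = R + ‖x‖ + 1 := by
    rw [norm_smul, Real.norm_of_nonneg (by positivity)]
    field_simp
  have h3 := norm_sub_le (x + ((R + ‖x‖ + 1) / ‖u‖) • u) x
  rw [add_sub_cancel_left, h2] at h3
  linarith

/-- If a bounded integral polyhedron contains two lattice points in direction `u` that are far apart
and the cylinder over it in direction `u` is not lattice-free, then it is not lattice-free. -/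
theorem not_isLatticeFree_of_cylinder {lam : ℝ} (hlam : IsBarycentricBound d s lam) (hs : 1 ≤ s)
    {P : Set (Fin d → ℝ)} (hP : IsPolytope P) (hint : IsIntegralSet P) {x u : Fin d → ℝ}
    {f : Fin d → ℤ} (hu : u ∈ intLattice d) (hfu : intFunctional f u = 1) {r : ℝ}
    (hr : s < lam * r) (hx : x ∈ P) (hxi : x ∈ intLattice d) (hy : x + r • u ∈ P)
    (hcyl : ¬ IsLatticeFree s (cylinder P u)) : ¬ IsLatticeFree s P := by
  classical
  obtain ⟨⟨m, a, b, ha, hPab⟩, hPb⟩ := hP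
  have hPc : Convex ℝ P := hint.convex
  obtain ⟨q₀, hq₀, hq₀l⟩ : (interior (cylinder P u) ∩ scaledLattice d s).Nonempty :=
    Set.nonempty_iff_ne_empty.2 hcyl
  have hPℓ : ∀ p ∈ P, ∀ j, dotFunctional (a j) p ≤ b j := fun p hp j => by
    rw [hPab] at hp
    rw [dotFunctional_apply]
    exact hp j
  -- The projection along `u` onto the kernel of `f`; it preserves integrality because `f` and `u`
  -- are integral.
  let φ : (Fin d → ℝ) →ₗ[ℝ] (Fin d → ℝ) := LinearMap.id - (intFunctional f).smulRight u
  have hφ : ∀ p, φ p = p - intFunctional f p • u := fun p => by simp [φ]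
  have hφu : φ u = 0 := by rw [hφ, hfu, one_smul, sub_self]
  have hφi : ∀ p ∈ intLattice d, φ p ∈ intLattice d := fun p hp => by
    obtain ⟨n, hn⟩ := intFunctional_intLattice f hp
    rw [hφ, hn]
    exact intLattice_sub hp (intLattice_zsmul hu n)
  -- Only the inequalities constant along `u` survive projection; their strictness is carried
  -- through the descent.
  let J := {j // dotFunctional (a j) u = 0}
  let ℓ : J → (Fin d → ℝ) →ₗ[ℝ] ℝ := fun j => dotFunctional (a j)
  have hℓφ : ∀ (j : J) p, ℓ j (φ p) = ℓ j p := fun j p => by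
    have : ℓ j u = 0 := j.2
    rw [hφ, map_sub, map_smul, this, smul_zero, sub_zero]
  have hKℓ : ∀ p ∈ φ '' P, ∀ j : J, ℓ j p ≤ b j := by
    rintro _ ⟨p, hp, rfl⟩ j
    rw [hℓφ]
    exact hPℓ p hp j
  have hq₀ℓ : ∀ j : J, ℓ j q₀ < b j := fun j => by
    obtain ⟨ε, hε, t, ht⟩ := exists_pos_add_smul_mem hq₀ (a j)
    have h1 := hPℓ _ ht j
    have h2 := mul_pos hε (dotFunctional_self_pos (ha j))
    have h3 : dotFunctional (a j) u = 0 := j.2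
    simp only [map_add, map_smul, smul_eq_mul, h3, mul_zero, add_zero] at h1
    change dotFunctional (a j) q₀ < b j
    linarith
  -- Going slightly past `q₀`, away from `x`, stays in the cylinder. Thus `φ q₀` is a convex
  -- combination in which `φ x` has positive weight.
  obtain ⟨ε, hε, t, ht⟩ := exists_pos_add_smul_mem hq₀ (q₀ - x)
  rw [hint] at ht
  obtain ⟨ι, _, z, c, hz, -, hc0, hc1, hcz⟩ := eq_pos_convex_span_of_mem_convexHull ht
  have hz' : ∀ i, z i ∈ P ∩ intLattice d := fun i => hz (Set.mem_range_self i)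
  have hε1 : 0 < 1 + ε := by linarith
  let v : Option ι → Fin d → ℝ := fun o => o.elim (φ x) fun i => φ (z i)
  let w : Option ι → ℝ := fun o => o.elim (ε / (1 + ε)) fun i => 1 / (1 + ε) * c i
  have hw1 : ∑ i, w i = 1 := by
    simp only [Fintype.sum_option, w, Option.elim, ← Finset.mul_sum, hc1]
    field_simp
    ring
  have hwv : ∑ i, w i • v i = φ q₀ := by
    simp only [Fintype.sum_option, w, v, Option.elim, mul_smul, ← Finset.smul_sum]
    simp only [← map_smul, ← map_sum, hcz]
    simp only [map_add, map_sub, map_smul, hφu]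
    have : ε / (1 + ε) = 1 - 1 / (1 + ε) := by field_simp; ring
    have h2 : 1 / (1 + ε) * ε = 1 - 1 / (1 + ε) := by field_simp; ring
    rw [smul_zero, add_zero, smul_add, smul_smul (1 / (1 + ε)), h2, this]
    module
  obtain ⟨κ, _, v', w', k₀, hk₀, hvK, hw'0, hw'1, hql, hqℓ, hlamw⟩ :=
    exists_rep_with_large_weight (ℓ := ℓ) (b := fun j : J => b j) hlam hs (K := φ '' P)
      (hPc.linear_image φ)
      ((LinearMap.toContinuousLinearMap φ).lipschitz.isBounded_image hPb) hKℓ v w none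
      (by rintro (_ | i); exacts [hφi x hxi, hφi _ (hz' i).2])
      (by rintro (_ | i); exacts [⟨x, hx, rfl⟩, ⟨z i, (hz' i).1, rfl⟩])
      (by rintro (_ | i); exacts [div_pos hε hε1, mul_pos (one_div_pos.2 hε1) (hc0 i)]) hw1
      (by
        rw [hwv]
        obtain ⟨y, hy, rfl⟩ := mem_scaledLattice_iff.1 hq₀l
        rw [map_smul]
        exact smul_mem_scaledLattice (hφi y hy))
      (fun j => by rw [hwv, hℓφ]; exact hq₀ℓ j)
  set q := ∑ k, w' k • v' k with hq
  choose p hp hpv using hvK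
  -- Vertices are lifted to `P`; the vertex `k₀` lifts both to `x` and to `x + r • u`, so the fibre
  -- over `q` contains a segment of length `w' k₀ * r` in units of `u`.
  let e : κ → Fin d → ℝ := fun k => if k = k₀ then x else p k
  have he : ∀ k, e k ∈ P := fun k => by
    simp only [e]; split_ifs; exacts [hx, hp k]
  have heφ : ∀ k, φ (e k) = v' k := fun k => by
    simp only [e]
    split_ifs with h
    · rw [h, hk₀]
      rfl
    · exact hpv k
  have hA : ∑ k, w' k • e k ∈ P := hPc.sum_mem (fun k _ => (hw'0 k).le) hw'1 fun k _ => he k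
  have hB : ∑ k, w' k • e k + (w' k₀ * r) • u ∈ P := by
    have h := hPc.sum_mem (t := Finset.univ) (z := fun k => e k + (if k = k₀ then r else 0) • u)
      (fun k _ => (hw'0 k).le) hw'1 fun k _ => by
        by_cases h : k = k₀
        · simpa [e, h] using hy
        · simpa [e, h] using hp k
    convert h using 1
    simp only [smul_add, Finset.sum_add_distrib, smul_smul, ← Finset.sum_smul]
    simp
  set t₁ := intFunctional f (∑ k, w' k • e k) with ht₁
  have hqA : ∑ k, w' k • e k = q + t₁ • u := by
    have : φ (∑ k, w' k • e k) = q := by simp only [map_sum, map_smul, heφ, hq]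
    rw [← this, hφ, sub_add_cancel]
  have hs0 : (0 : ℝ) < s := by exact_mod_cast hs
  have hr0 : 0 < r := by
    by_contra h
    have := mul_nonpos_of_nonneg_of_nonpos hlam.1.le (not_lt.1 h)
    linarith
  have hgap : (s : ℝ) < w' k₀ * r := hr.trans_le (mul_le_mul_of_nonneg_right hlamw hr0.le)
  -- The first multiple of `s` strictly beyond `t₁`; it precedes the other end because the gap
  -- exceeds `s`.
  set n : ℤ := ⌊t₁ / s⌋ + 1 with hn
  have hn1 : t₁ < s * n := by
    have := Int.lt_floor_add_one (t₁ / s)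
    rw [div_lt_iff₀ hs0] at this
    rw [hn]; push_cast; linarith
  have hn2 : (s : ℝ) * n < t₁ + w' k₀ * r := by
    have := Int.floor_le (t₁ / s)
    rw [le_div_iff₀ hs0] at this
    rw [hn]; push_cast; linarith
  refine fun hfree => Set.eq_empty_iff_forall_notMem.1 hfree (q + (s : ℝ) • (n : ℝ) • u) ⟨?_, ?_⟩
  · rw [hPab]
    refine mem_interior_of_forall_lt fun j => ?_
    have h1 := hPℓ _ hA j
    have h2 := hPℓ _ hB j
    rw [hqA] at h1 h2
    simp only [map_add, map_smul, smul_eq_mul] at h1 h2 ⊢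
    -- Inequalities that vary along `u` are strict strictly inside the segment; constant ones are
    -- strict at `q` already.
    rcases lt_trichotomy (dotFunctional (a j) u) 0 with h | h | h
    · have := mul_lt_mul_of_neg_right hn1 h
      linarith
    · have := hqℓ ⟨j, h⟩
      simp only [ℓ] at this
      simpa [h] using this
    · have := mul_lt_mul_of_pos_right hn2 h
      linarith
  · exact scaledLattice_add hql (smul_mem_scaledLattice (intLattice_zsmul hu n))

theorem encard_le_of_maximal {lam : ℝ} (hlam : IsBarycentricBound d s lam) (hs : 1 ≤ s)
    {P : Set (Fin d → ℝ)} (hP : IsPolytope P) (hmax : P ∈ maximalFreeIntegralPolyhedra d s) :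
    (P ∩ scaledLattice d s).encard ≤ ((⌈1 / lam + 1⌉₊ ^ d : ℕ) : ℕ∞) := by
  by_contra hcon
  have hpos : 0 < 1 / lam + 1 := by have := one_div_pos.2 hlam.1; linarith
  obtain ⟨x, ⟨hx, hxl⟩, z, hz, hy, -⟩ :=
    exists_congruent_of_encard_lt (Nat.ceil_pos.2 hpos) Set.inter_subset_right (not_le.1 hcon)
  obtain ⟨γ, u, f, hγ, rfl, huf⟩ := exists_primitive hz
  have hs0 : (0 : ℝ) < s := by exact_mod_cast hs
  have hγ1 : (1 : ℝ) ≤ γ := by exact_mod_cast hγ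
  set U : Fin d → ℝ := fun i => (u i : ℝ) with hU
  have hUi : U ∈ intLattice d := ⟨u, rfl⟩
  have hfU : intFunctional f U = 1 := by
    rw [intFunctional_apply]
    simp only [hU, mul_comm (f _ : ℝ)]
    exact_mod_cast huf
  have hU0 : U ≠ 0 := fun h => by simp [h] at hfU
  set N := ⌈1 / lam + 1⌉₊ with hN
  -- The `+ 1` under the ceiling gives `lam * N ≥ 1 + lam`, hence strictness.
  have hlamN : 1 < lam * N := by
    have h1 := mul_le_mul_of_nonneg_left (Nat.le_ceil (1 / lam + 1)) hlam.1.le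
    rw [mul_add, mul_one_div_cancel hlam.1.ne', mul_one] at h1
    have := hlam.1
    linarith
  have hr : (s : ℝ) < lam * (N * s * γ) := by
    have h1 : (s : ℝ) * 1 < s * (lam * N) := mul_lt_mul_of_pos_left hlamN hs0
    have h2 : s * (lam * N) * 1 ≤ s * (lam * N) * γ :=
      mul_le_mul_of_nonneg_left hγ1 (by linarith)
    linarith
  have hy' : x + ((N : ℝ) * s * γ) • U ∈ P := by
    convert hy using 2
    ext i
    simp [hU]
    ring
  obtain ⟨⟨hpoly, hint, hfree⟩, hmax⟩ := hmax
  refine not_isLatticeFree_of_cylinder hlam hs hP hint hUi hfU hr hx (scaledLattice_subset hxl) hy'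
    (fun hcyl => ?_) hfree
  exact not_cylinder_subset hP.2 hx hU0
    (hmax ⟨hpoly.cylinder ⟨x, hx⟩ U, hint.cylinder hUi, hcyl⟩ (subset_cylinder P U))

end Bound

theorem mainTheorem5 (d s : ℕ) (hd : 1 ≤ d) (hs : 1 ≤ s) :
    (∃ N : ℕ, 0 < N ∧
      ∀ P : Set (Fin d → ℝ), IsPolytope P → P ∈ maximalFreeIntegralPolyhedra d s →
        (P ∩ scaledLattice d s).encard ≤ (N : ℕ∞)) ∧
    (∃ lam : ℝ, IsBarycentricBound d s lam) ∧
    (∀ lam : ℝ, IsBarycentricBound d s lam →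
      ∀ P : Set (Fin d → ℝ), IsPolytope P → P ∈ maximalFreeIntegralPolyhedra d s →
        (P ∩ scaledLattice d s).encard ≤ ((⌈1 / lam + 1⌉₊ ^ d : ℕ) : ℕ∞)) := by
  obtain ⟨lam, hlam⟩ := exists_isBarycentricBound d hs
  refine ⟨⟨⌈1 / lam + 1⌉₊ ^ d, pow_pos (Nat.ceil_pos.2 ?_) d, fun P hP hmax =>
    encard_le_of_maximal hlam hs hP hmax⟩, ⟨lam, hlam⟩, fun l hl P hP hmax =>
    encard_le_of_maximal hl hs hP hmax⟩
  have := one_div_pos.2 hlam.1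
  linarith
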